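/- Let $n\in\mathbb{N}$ and let $\Omega\subset\mathbb{R}^n$ be a connected open set. Let $g:\mathbb{R}\to\mathbb{R}$ be continuous and suppose there exists $s_0\ge 0$ such that $g\ge 0$ on $[s_0,\infty)$ and $g\le 0$ on $(-\infty,-s_0]$. Suppose that $u\in C^2(\Omega)$ satisfies $$\Delta_\infty u+g(u)|Du|^4=0\quad\text{in }\Omega,\qquad\text{where }\Delta_\infty u=\langle D^2u\,Du,Du\rangle .$$ Then either $Du(x)\neq 0$ for every $x\in\Omega$, or $u$ is constant in $\Omega$. -/

import Mathlib

/-- The infinity-Laplacian `Δ_∞ u (x) = ⟨D²u(x) Du(x), Du(x)⟩` of a function on `ℝⁿ`.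
The Hessian `D²u(x)` is the derivative at `x` of the gradient field `Du`. -/
noncomputable def infinityLaplacian {n : ℕ} (u : EuclideanSpace ℝ (Fin n) → ℝ)
    (x : EuclideanSpace ℝ (Fin n)) : ℝ :=
  inner ℝ (fderiv ℝ (gradient u) x (gradient u x)) (gradient u x)

/-!
The gradient term can be removed by a change of variable. If `G'' = g G'` with `G' > 0`, then
`v = G ∘ u` is again `C²`, has the same critical points as `u`, and satisfies `Δ_∞ v = 0`
(`exists_contDiff_deriv_eq_mul`, `infinityLaplacian_comp`).

For the infinity-harmonic function `v` put `F = Dv` and `p = |F|²`. The equation says exactly that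
`p` is constant along the integral curves of `F`. Since `DF` is symmetric, `½ Dp = DF F` is the
acceleration of these curves, so `p` formally solves `⟨D²p F, F⟩ + ½ |Dp|² = 0`.
As `p` is only `C¹`, this is used in the following viscosity form: the radial function
`c (|x - y|⁻² - R⁻²)` cannot touch `p`, up to a negative additive constant, from below
(`le_norm_sq_of_isLocalMin_sub_barrier`). Comparison with this barrier on an annulus, as in
the proof of Hopf's lemma, shows that if `F y ≠ 0` then `F` has no zero in any ball centred at `y`
whose closure lies in the domain (`ne_zero_of_mem_ball`).

The set of noncritical points is therefore relatively closed as well as open in `Ω`, so by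
connectedness it is empty, and `u` is constant, or all of `Ω`.
-/

open Filter Topology Metric Set

/-! ### Fields with symmetric derivative and norm constant along integral curves -/

section ConservativeField

variable {E : Type*} [NormedAddCommGroup E] [InnerProductSpace ℝ E]

/-- Touching from below by the barrier `c / |z - y|²`, for a field `F` with symmetric derivative
whose norm is constant along its own integral curves. If the inequality failed at the touching
point, the squared distance to `y` along the integral curve through `x` would be strictly concave
at `x`; but there it has a local minimum, because `‖F‖²` is constant along the curve. -/
theorem le_norm_sq_of_isLocalMin_sub_barrier [CompleteSpace E] {F : E → E} {x y : E} {c : ℝ}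
    (hc : 0 < c) (hxy : x ≠ y) (hF : ContDiffAt ℝ 1 F x)
    (hsymm : ∀ a b, inner ℝ (fderiv ℝ F x a) b = inner ℝ a (fderiv ℝ F x b))
    (hflow : ∀ᶠ z in 𝓝 x, inner ℝ (fderiv ℝ F z (F z)) (F z) = 0)
    (hmin : IsLocalMin (fun z => ‖F z‖ ^ 2 - c / ‖z - y‖ ^ 2) x) :
    c / ‖x - y‖ ^ 2 ≤ ‖F x‖ ^ 2 := by
  by_contra! hlt
  have hs : 0 < ‖x - y‖ ^ 2 := by
    have := norm_pos_iff.2 (sub_ne_zero.2 hxy)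
    positivity
  have hFx : HasFDerivAt F (fderiv ℝ F x) x := (hF.differentiableAt one_ne_zero).hasFDerivAt
  -- The first-order condition at the minimum, tested in the radial direction `x - y`.
  have hradial : inner ℝ (fderiv ℝ F x (F x)) (x - y) = -(c / ‖x - y‖ ^ 2) := by
    have hd := hFx.norm_sq.sub (((hasDerivAt_inv hs.ne').comp_hasFDerivAt x
      ((hasFDerivAt_id x).sub_const y).norm_sq).const_mul c)
    have h0 := congrArg (fun L => L (x - y)) (IsLocalMin.hasFDerivAt_eq_zero
      (f := fun z => ‖F z‖ ^ 2 - c * (‖z - y‖ ^ 2)⁻¹) (by simpa only [div_eq_mul_inv] using hmin) hd)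
    simp only [id, sub_apply, smul_apply, ContinuousLinearMap.comp_apply,
      ContinuousLinearMap.id_apply, zero_apply, innerSL_apply_apply,
      real_inner_self_eq_norm_sq, ← hsymm, smul_eq_mul, nsmul_eq_mul, neg_mul] at h0
    field_simp at h0 ⊢
    push_cast at h0
    linarith
  obtain ⟨γ, hγ0, ε, hε, hγ⟩ :=
    hF.exists_forall_mem_closedBall_exists_eq_forall_mem_Ioo_hasDerivAt₀ 0
  have hγ' : ∀ᶠ t in 𝓝 (0 : ℝ), HasDerivAt γ (F (γ t)) t := by
    filter_upwards [Ioo_mem_nhds (by linarith : 0 - ε < 0) (by linarith : 0 < 0 + ε)] using hγ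
  have hγx : Tendsto γ (𝓝 0) (𝓝 x) := by
    simpa only [hγ0] using hγ'.self_of_nhds.continuousAt.tendsto
  have hconst : ∀ᶠ t in 𝓝 (0 : ℝ), ‖F (γ t)‖ ^ 2 = ‖F x‖ ^ 2 := by
    have hev : ∀ᶠ t in 𝓝 (0 : ℝ), HasDerivAt (fun t => ‖F (γ t)‖ ^ 2) 0 t := by
      filter_upwards [hγ', hγx.eventually hflow,
        hγx.eventually (hF.eventually (by simp))] with t h1 h2 h3
      have := (((h3.differentiableAt one_ne_zero).hasFDerivAt).comp_hasDerivAt t h1).norm_sq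
      rwa [Function.comp_apply, real_inner_comm, h2, mul_zero] at this
    obtain ⟨δ, hδ, hball⟩ := Metric.eventually_nhds_iff_ball.1 hev
    filter_upwards [ball_mem_nhds 0 hδ] with t ht
    have := isOpen_ball.is_const_of_deriv_eq_zero (convex_ball (0 : ℝ) δ).isPreconnected
      (fun s hs => (hball s hs).differentiableAt.differentiableWithinAt)
      (fun s hs => (hball s hs).deriv) ht (mem_ball_self hδ)
    simpa only [hγ0] using this
  have hsmin : IsLocalMin (fun t => ‖γ t - y‖ ^ 2) 0 := by
    have hm : ∀ᶠ z in 𝓝 x, ‖F x‖ ^ 2 - c / ‖x - y‖ ^ 2 ≤ ‖F z‖ ^ 2 - c / ‖z - y‖ ^ 2 := hmin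
    filter_upwards [hγx.eventually hm, hconst,
      hγx.eventually (isOpen_ne.mem_nhds hxy)] with t h1 h2 h3
    have hpos : 0 < ‖γ t - y‖ ^ 2 := by
      have := norm_pos_iff.2 (sub_ne_zero.2 h3)
      positivity
    have : c / ‖γ t - y‖ ^ 2 ≤ c / ‖x - y‖ ^ 2 := by linarith
    rw [hγ0]
    exact (div_le_div_iff_of_pos_left hc hpos hs).1 this
  have hd1 : ∀ᶠ t in 𝓝 (0 : ℝ),
      HasDerivAt (fun t => ‖γ t - y‖ ^ 2) (2 * inner ℝ (γ t - y) (F (γ t))) t := by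
    filter_upwards [hγ'] with t ht
    exact (ht.sub_const y).norm_sq
  have hd2 : HasDerivAt (fun t => 2 * inner ℝ (γ t - y) (F (γ t)))
      (2 * (‖F x‖ ^ 2 - c / ‖x - y‖ ^ 2)) 0 := by
    have hFγ : HasDerivAt (fun t => F (γ t)) (fderiv ℝ F x (F x)) 0 := by
      have := hγ'.self_of_nhds
      rw [hγ0] at this
      exact HasFDerivAt.comp_hasDerivAt_of_eq 0 hFx this hγ0.symm
    have := (((hγ'.self_of_nhds.sub_const y).inner ℝ hFγ).const_mul 2)
    refine this.congr_deriv ?_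
    rw [hγ0, real_inner_comm _ (x - y), hradial, real_inner_self_eq_norm_sq]
    ring
  have hderiv : deriv (fun t => ‖γ t - y‖ ^ 2) =ᶠ[𝓝 0] fun t => 2 * inner ℝ (γ t - y) (F (γ t)) := by
    filter_upwards [hd1] with t ht using ht.deriv
  have hneg : deriv (deriv fun t => ‖γ t - y‖ ^ 2) 0 < 0 := by
    rw [hderiv.deriv_eq, hd2.deriv]
    linarith
  -- Being both a local minimum and a local maximum, the squared distance is locally constant,
  -- against the sign of its second derivative.
  have hsmax := isLocalMax_of_deriv_deriv_neg hneg hsmin.deriv_eq_zero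
    hd1.self_of_nhds.continuousAt
  have hloc : (fun t => ‖γ t - y‖ ^ 2) =ᶠ[𝓝 0] fun _ => ‖γ 0 - y‖ ^ 2 := by
    filter_upwards [hsmin, hsmax] with t h1 h2 using le_antisymm h2 h1
  have := hloc.deriv.deriv_eq
  simp at this
  simp [this] at hneg

/-- Propagation of positivity: a zero of `F` inside the ball would violate the comparison
`c (‖z - y‖⁻² - R⁻²) ≤ ‖F z‖²` on the annulus `ρ ≤ ‖z - y‖ ≤ R`, where `ρ` is the radius of a ball
on which `‖F‖` is bounded below. -/
theorem ne_zero_of_mem_ball [ProperSpace E] {F : E → E} {x y : E} {R : ℝ}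
    (hF : ∀ z ∈ closedBall y R, ContDiffAt ℝ 1 F z)
    (hsymm : ∀ z ∈ ball y R, ∀ a b,
      inner ℝ (fderiv ℝ F z a) b = inner ℝ a (fderiv ℝ F z b))
    (hflow : ∀ z ∈ ball y R, inner ℝ (fderiv ℝ F z (F z)) (F z) = 0)
    (hy : F y ≠ 0) (hx : x ∈ ball y R) : F x ≠ 0 := by
  intro hx0
  have hxR : ‖x - y‖ < R := mem_ball_iff_norm.1 hx
  have hxy : 0 < ‖x - y‖ := norm_pos_iff.2 (sub_ne_zero.2 fun h => hy (h ▸ hx0))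
  have hRpos : 0 < R := hxy.trans hxR
  have hcont : ContinuousAt F y := (hF y (mem_closedBall_self hRpos.le)).continuousAt
  obtain ⟨ρ, hρ, hρF⟩ : ∃ ρ > 0, ∀ z ∈ closedBall y ρ, ‖F y‖ / 2 < ‖F z‖ := by
    have : ∀ᶠ z in 𝓝 y, ‖F y‖ / 2 < ‖F z‖ :=
      hcont.norm.eventually (lt_mem_nhds (half_lt_self (norm_pos_iff.2 hy)))
    obtain ⟨ρ, hρ, h⟩ := Metric.nhds_basis_closedBall.eventually_iff.1 this
    exact ⟨ρ, hρ, fun z hz => h hz⟩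
  have hFy : 0 < ‖F y‖ := norm_pos_iff.2 hy
  have hxρ : ρ < ‖x - y‖ := by
    by_contra! h
    have := hρF x (mem_closedBall_iff_norm.2 h)
    rw [hx0, norm_zero] at this
    linarith
  -- The constant for which `c / ‖z - y‖²` equals the lower bound of `‖F‖²` on the inner sphere.
  set c : ℝ := ρ ^ 2 * (‖F y‖ / 2) ^ 2 with hc_def
  have hc : 0 < c := by positivity
  set Q : E → ℝ := fun z => ‖F z‖ ^ 2 - c / ‖z - y‖ ^ 2 with hQ
  set A : Set E := closedBall y R \ ball y ρ with hA
  have hAmem : ∀ z, z ∈ A ↔ ‖z - y‖ ≤ R ∧ ρ ≤ ‖z - y‖ := by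
    intro z
    simp [hA, dist_eq_norm]
  have hAcpt : IsCompact A := (isCompact_closedBall y R).diff isOpen_ball
  have hQcont : ContinuousOn Q A := by
    intro z hz
    have hz' := (hAmem z).1 hz
    have hne : ‖z - y‖ ^ 2 ≠ 0 := by
      have := hρ.trans_le hz'.2
      positivity
    have h1 := (hF z hz.1).continuousAt
    have : ContinuousAt Q z := by
      refine (h1.norm.pow 2).sub (continuousAt_const.div ?_ hne)
      fun_prop
    exact this.continuousWithinAt
  obtain ⟨z, hzA, hzmin⟩ := hAcpt.exists_isMinOn ⟨x, (hAmem x).2 ⟨hxR.le, hxρ.le⟩⟩ hQcont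
  have hzx : Q z ≤ Q x := hzmin ((hAmem x).2 ⟨hxR.le, hxρ.le⟩)
  have hQx : Q x < -(c / R ^ 2) := by
    have : c / R ^ 2 < c / ‖x - y‖ ^ 2 := by gcongr
    simp only [hQ, hx0, norm_zero]
    linarith
  have hz := (hAmem z).1 hzA
  have hcR : 0 < c / R ^ 2 := by positivity
  -- The value of `Q` at the zero `x` is too small for the minimum to lie on either sphere.
  have hzR : ‖z - y‖ < R := by
    refine lt_of_le_of_ne hz.1 fun h => ?_
    have : -(c / R ^ 2) ≤ Q z := by
      simp only [hQ, h]
      linarith [sq_nonneg ‖F z‖]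
    linarith
  have hzρ : ρ < ‖z - y‖ := by
    refine lt_of_le_of_ne hz.2 fun h => ?_
    have h1 := hρF z (mem_closedBall_iff_norm.2 h.ge)
    have h2 : (‖F y‖ / 2) ^ 2 ≤ ‖F z‖ ^ 2 := by gcongr
    have h3 : c / ρ ^ 2 = (‖F y‖ / 2) ^ 2 := by
      rw [hc_def]
      field_simp
    have : 0 ≤ Q z := by
      simp only [hQ, ← h, h3]
      linarith
    linarith
  have hzball : z ∈ ball y R := mem_ball_iff_norm.2 hzR
  have hzint : A ∈ 𝓝 z := by
    have h1 : ∀ᶠ w in 𝓝 z, ‖w - y‖ < R :=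
      ContinuousAt.eventually_lt (by fun_prop) continuousAt_const hzR
    have h2 : ∀ᶠ w in 𝓝 z, ρ < ‖w - y‖ :=
      ContinuousAt.eventually_lt continuousAt_const (by fun_prop) hzρ
    filter_upwards [h1, h2] with w hw1 hw2 using (hAmem w).2 ⟨hw1.le, hw2.le⟩
  have hzy : z ≠ y := sub_ne_zero.1 (norm_pos_iff.1 (hρ.trans hzρ))
  have := le_norm_sq_of_isLocalMin_sub_barrier hc hzy (hF z hzA.1) (hsymm z hzball)
    (by filter_upwards [isOpen_ball.mem_nhds hzball] using hflow) (hzmin.isLocalMin hzint)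
  have hQz : 0 ≤ Q z := by
    simp only [hQ]
    linarith
  linarith

end ConservativeField

/-! ### The gradient of a twice continuously differentiable function -/

section Gradient

variable {E : Type*} [NormedAddCommGroup E] [InnerProductSpace ℝ E] [CompleteSpace E]

theorem ContDiffAt.gradient {v : E → ℝ} {x : E} (hv : ContDiffAt ℝ 2 v x) :
    ContDiffAt ℝ 1 (gradient v) x :=
  ((InnerProductSpace.toDual ℝ E).symm.toContinuousLinearEquiv.contDiff.contDiffAt).comp x
    (hv.fderiv_right (by norm_num))

theorem inner_fderiv_gradient_left {v : E → ℝ} {x : E} (hv : ContDiffAt ℝ 2 v x) (a b : E) :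
    inner ℝ (fderiv ℝ (gradient v) x a) b = fderiv ℝ (fderiv ℝ v) x a b := by
  have h1 := (hv.gradient.differentiableAt one_ne_zero).hasFDerivAt
  have h2 : HasFDerivAt (fderiv ℝ v) (fderiv ℝ (fderiv ℝ v) x) x :=
    ((hv.fderiv_right (m := 1) (by norm_num)).differentiableAt one_ne_zero).hasFDerivAt
  have h3 := (InnerProductSpace.toDual ℝ E).toContinuousLinearEquiv.hasFDerivAt.comp x h1
  have h4 := congrArg (fun L => L a b) (h3.unique (by simpa [Function.comp_def] using h2))
  simpa using h4

theorem inner_fderiv_gradient_comm {v : E → ℝ} {x : E} (hv : ContDiffAt ℝ 2 v x) (a b : E) :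
    inner ℝ (fderiv ℝ (gradient v) x a) b = inner ℝ a (fderiv ℝ (gradient v) x b) := by
  rw [real_inner_comm _ a, inner_fderiv_gradient_left hv, inner_fderiv_gradient_left hv]
  exact (hv.isSymmSndFDerivAt (by simp)).eq a b

theorem gradient_comp_of_hasDerivAt {G : ℝ → ℝ} {G' : ℝ} {u : E → ℝ} {x : E}
    (hG : HasDerivAt G G' (u x)) (hu : DifferentiableAt ℝ u x) :
    gradient (fun z => G (u z)) x = G' • gradient u x := by
  have := hG.comp_hasFDerivAt x hu.hasFDerivAt
  simp [gradient, show fderiv ℝ (fun z => G (u z)) x = _ from this.fderiv]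

end Gradient

/-! ### Removing the gradient term -/

/-- The change of variable removing the gradient term: `G' = h = exp (∫ g)`. -/
theorem exists_contDiff_deriv_eq_mul {g : ℝ → ℝ} (hg : Continuous g) :
    ∃ G h : ℝ → ℝ, ContDiff ℝ 2 G ∧ (∀ s, 0 < h s) ∧ (∀ s, HasDerivAt G (h s) s) ∧
      ∀ s, HasDerivAt h (g s * h s) s := by
  have hH (s : ℝ) : HasDerivAt (fun t => ∫ r in (0 : ℝ)..t, g r) (g s) s :=
    intervalIntegral.integral_hasDerivAt_right (hg.intervalIntegrable _ _)
      hg.stronglyMeasurable.stronglyMeasurableAtFilter hg.continuousAt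
  set h : ℝ → ℝ := fun s => Real.exp (∫ r in (0 : ℝ)..s, g r) with hh
  have hh' (s : ℝ) : HasDerivAt h (g s * h s) s := by
    simpa [mul_comm] using (hH s).exp
  have hhc : Continuous h := continuous_iff_continuousAt.2 fun s => (hh' s).continuousAt
  have hG (s : ℝ) : HasDerivAt (fun t => ∫ r in (0 : ℝ)..t, h r) (h s) s :=
    intervalIntegral.integral_hasDerivAt_right (hhc.intervalIntegrable _ _)
      hhc.stronglyMeasurable.stronglyMeasurableAtFilter hhc.continuousAt
  refine ⟨_, h, ?_, fun s => Real.exp_pos _, hG, hh'⟩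
  have hh1 : ContDiff ℝ 1 h := contDiff_one_iff_deriv.2
    ⟨fun s => (hh' s).differentiableAt, by
      rw [funext fun s => (hh' s).deriv]
      exact hg.mul hhc⟩
  rw [show (2 : WithTop ℕ∞) = 1 + 1 by norm_num, contDiff_succ_iff_deriv]
  refine ⟨fun s => (hG s).differentiableAt, by simp, ?_⟩
  rwa [funext fun s => (hG s).deriv]

theorem infinityLaplacian_comp {n : ℕ} {u : EuclideanSpace ℝ (Fin n) → ℝ}
    {x : EuclideanSpace ℝ (Fin n)} {G h : ℝ → ℝ} {k : ℝ} (hu : ContDiffAt ℝ 2 u x)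
    (hG : ∀ s, HasDerivAt G (h s) s) (hh : HasDerivAt h k (u x)) :
    infinityLaplacian (fun z => G (u z)) x =
      h (u x) ^ 3 * infinityLaplacian u x + h (u x) ^ 2 * k * ‖gradient u x‖ ^ 4 := by
  have hux : DifferentiableAt ℝ u x := hu.differentiableAt two_ne_zero
  have hgrad : gradient (fun z => G (u z)) =ᶠ[𝓝 x] fun z => h (u z) • gradient u z := by
    filter_upwards [hu.eventually (by simp)] with z hz
    exact gradient_comp_of_hasDerivAt (hG _) (hz.differentiableAt two_ne_zero)
  have hd := (hh.comp_hasFDerivAt x hux.hasFDerivAt).smul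
    (hu.gradient.differentiableAt one_ne_zero).hasFDerivAt
  have hd' : fderiv ℝ (fun z => h (u z) • gradient u z) x = _ := hd.fderiv
  have hsq : fderiv ℝ u x (gradient u x) = ‖gradient u x‖ ^ 2 := by
    rw [← inner_gradient_left, real_inner_self_eq_norm_sq]
  simp only [infinityLaplacian, hgrad.fderiv_eq, hgrad.self_of_nhds, hd']
  simp [hsq, inner_smul_right]
  ring

/-! ### Critical points -/

theorem theorem3p1 {n : ℕ} (Ω : Set (EuclideanSpace ℝ (Fin n)))
    (hΩ_open : IsOpen Ω) (hΩ_conn : IsConnected Ω)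
    (g : ℝ → ℝ) (hg_cont : Continuous g)
    (hg_sign : ∃ s₀ : ℝ, 0 ≤ s₀ ∧ (∀ s, s₀ ≤ s → 0 ≤ g s) ∧ (∀ s, s ≤ -s₀ → g s ≤ 0))
    (u : EuclideanSpace ℝ (Fin n) → ℝ) (hu : ContDiffOn ℝ 2 u Ω)
    (hu_eq : ∀ x ∈ Ω, infinityLaplacian u x + g (u x) * ‖gradient u x‖ ^ 4 = 0) :
    (∀ x ∈ Ω, gradient u x ≠ 0) ∨ (∃ c : ℝ, ∀ x ∈ Ω, u x = c) := by
  have hu' (x) (hx : x ∈ Ω) : ContDiffAt ℝ 2 u x := hu.contDiffAt (hΩ_open.mem_nhds hx)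
  obtain ⟨G, h, hGc, hpos, hG, hh⟩ := exists_contDiff_deriv_eq_mul hg_cont
  set v : EuclideanSpace ℝ (Fin n) → ℝ := fun z => G (u z) with hv_def
  have hv (x) (hx : x ∈ Ω) : ContDiffAt ℝ 2 v x := hGc.contDiffAt.comp x (hu' x hx)
  have hv_eq (x) (hx : x ∈ Ω) : infinityLaplacian v x = 0 := by
    rw [infinityLaplacian_comp (hu' x hx) hG (hh _)]
    linear_combination h (u x) ^ 3 * hu_eq x hx
  have hv_zero (x) (hx : x ∈ Ω) : gradient v x = 0 ↔ gradient u x = 0 := by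
    rw [gradient_comp_of_hasDerivAt (hG _) ((hu' x hx).differentiableAt two_ne_zero),
      smul_eq_zero_iff_right (hpos _).ne']
  by_cases hcrit : ∀ x ∈ Ω, gradient u x = 0
  · refine .inr (hΩ_open.exists_is_const_of_fderiv_eq_zero hΩ_conn.isPreconnected
      (hu.differentiableOn two_ne_zero) fun x hx => ?_)
    simpa [gradient] using hcrit x hx
  left
  push Not at hcrit
  obtain ⟨x₀, hx₀, hx₀'⟩ := hcrit
  have hgc : ContinuousOn (gradient v) Ω := fun x hx =>
    (hv x hx).gradient.continuousAt.continuousWithinAt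
  have hsub := hΩ_conn.isPreconnected.subset_of_closure_inter_subset
    (u := Ω ∩ gradient v ⁻¹' {0}ᶜ) (hgc.isOpen_inter_preimage hΩ_open isOpen_compl_singleton)
    ⟨x₀, hx₀, hx₀, fun h0 => hx₀' ((hv_zero x₀ hx₀).1 h0)⟩ ?_
  · exact fun x hx h0 => (hsub hx).2 ((hv_zero x hx).2 h0)
  rintro x ⟨hxcl, hx⟩
  refine ⟨hx, ?_⟩
  obtain ⟨r, hr, hrΩ⟩ := Metric.isOpen_iff.1 hΩ_open x hx
  obtain ⟨y, ⟨hyΩ, hy⟩, hxy⟩ := Metric.mem_closure_iff.1 hxcl (r / 2) (half_pos hr)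
  have hball : closedBall y (r / 2) ⊆ Ω := fun z hz => hrΩ <| by
    rw [mem_closedBall] at hz
    rw [mem_ball]
    linarith [dist_triangle z y x, dist_comm x y]
  exact ne_zero_of_mem_ball (fun z hz => (hv z (hball hz)).gradient)
    (fun z hz => inner_fderiv_gradient_comm (hv z (hball (ball_subset_closedBall hz))))
    (fun z hz => hv_eq z (hball (ball_subset_closedBall hz))) hy hxy
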